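/- Let $\mathcal H$ and $\mathcal K$ be real Hilbert spaces, let $f\colon\mathcal H\to\mathbb R\cup\{+\infty\}$ and $g\colon\mathcal K\to\mathbb R\cup\{+\infty\}$ be proper, convex and lower semicontinuous, and let $L\colon\mathcal H\to\mathcal K$ be a nonzero bounded linear operator with adjoint $L^*$ and operator norm $\|L\|$. Write $g^*(u)=\sup_{v\in\mathcal K}\left(\langle u,v\rangle-g(v)\right)$ for the convex conjugate of $g$, $\partial$ for the convex subdifferential, and $\operatorname{prox}_{\tau h}(z)=\operatorname{argmin}_{w}\left(h(w)+\tfrac{1}{2\tau}\|w-z\|^2\right)$ for the proximal operator. Call $(x_\star,y_\star)\in\mathcal H\times\mathcal K$ a KKT point of the saddle-point problem $\min_{x\in\mathcal H}\max_{y\in\mathcal K} f(x)+\langle Lx,y\rangle-g^*(y)$ if $$-L^*y_\star\in\partial f(x_\star)\quad\text{and}\quad Lx_\star\in\partial g^*(y_\star),$$ and assume that at least one KKT point exists. Let $\tau,\sigma>0$ and $\theta>\tfrac12$ satisfy $$\tau\sigma\|L\|^2<\frac{4}{1+2\theta},$$ let $(x_0,y_0)\in\mathcal H\times\mathcal K$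 be arbitrary, and let $(x_k)_{k\ge0}$, $(y_k)_{k\ge0}$ be generated by the Chambolle–Pock iteration $$x_{k+1}=\operatorname{prox}_{\tau f}\left(x_k-\tau L^*y_k\right),\qquad y_{k+1}=\operatorname{prox}_{\sigma g^*}\left(y_k+\sigma L\left(x_{k+1}+\theta(x_{k+1}-x_k)\right)\right).$$ Then there is a KKT point $(x_\star,y_\star)\in\mathcal H\times\mathcal K$ such that $(x_k,y_k)$ converges weakly to $(x_\star,y_\star)$ in $\mathcal H\times\mathcal K$ as $k\to\infty$. -/

import Mathlib

open Filter Topology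

namespace ChambollePock

noncomputable section

/-- An extended-real-valued function is proper if it never takes the value `-∞` and is not
identically `+∞`. -/
def IsProper {X : Type*} (f : X → EReal) : Prop :=
  (∀ x, f x ≠ ⊥) ∧ ∃ x, f x ≠ ⊤

/-- Convexity of an extended-real-valued function. (For functions that never take the value `-∞`
no sum `∞ - ∞` occurs on the right; moreover `0 * ⊤ = 0` and `a * ⊤ = ⊤` for `0 < a`.) -/
def IsConvex {X : Type*} [AddCommGroup X] [Module ℝ X] (f : X → EReal) : Prop :=
  ∀ x y : X, ∀ a b : ℝ, 0 ≤ a → 0 ≤ b → a + b = 1 →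
    f (a • x + b • y) ≤ (a : EReal) * f x + (b : EReal) * f y

/-- The class of proper, convex, lower semicontinuous functions. -/
structure ProperConvexLsc {X : Type*} [NormedAddCommGroup X] [InnerProductSpace ℝ X]
    (f : X → EReal) : Prop where
  proper : IsProper f
  convex : IsConvex f
  lsc : LowerSemicontinuous f

/-- The subdifferential `∂f(x) = {u | ∀ z, f z ≥ f x + ⟪u, z - x⟫}`. -/
def subdifferential {X : Type*} [NormedAddCommGroup X] [InnerProductSpace ℝ X]
    (f : X → EReal) (x : X) : Set X :=
  {u | ∀ z : X, f x + ((inner ℝ u (z - x) : ℝ) : EReal) ≤ f z}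

/-- The convex conjugate `f*(u) = sup_x (⟪u, x⟫ - f x)`. -/
def conjugate {X : Type*} [NormedAddCommGroup X] [InnerProductSpace ℝ X]
    (f : X → EReal) (u : X) : EReal :=
  ⨆ x : X, (((inner ℝ u x : ℝ) : EReal) - f x)

/-- `IsProx τ f x p` says that `p = prox_{τ f}(x)`, i.e. that `p` minimizes
`y ↦ f y + ‖y - x‖² / (2 τ)` over the whole space. For proper, convex, lower semicontinuous `f` on
a Hilbert space and `τ > 0` there is exactly one such `p`. -/
def IsProx {X : Type*} [NormedAddCommGroup X] [InnerProductSpace ℝ X]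
    (τ : ℝ) (f : X → EReal) (x p : X) : Prop :=
  ∀ y : X, f p + ((1 / (2 * τ) * ‖p - x‖ ^ 2 : ℝ) : EReal) ≤
    f y + ((1 / (2 * τ) * ‖y - x‖ ^ 2 : ℝ) : EReal)

variable {H : Type*} [NormedAddCommGroup H] [InnerProductSpace ℝ H] [CompleteSpace H]
  {K : Type*} [NormedAddCommGroup K] [InnerProductSpace ℝ K] [CompleteSpace K]

/-- The Karush–Kuhn–Tucker condition for
`minimize over x, maximize over y : f x + ⟪L x, y⟫ - g* y`. -/
def IsKKT (f : H → EReal) (g : K → EReal) (L : H →L[ℝ] K) (x : H) (y : K) : Prop :=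
  -(ContinuousLinearMap.adjoint L y) ∈ subdifferential f x ∧
    L x ∈ subdifferential (conjugate g) y

/-- The sequences `x`, `y` are generated by the Chambolle–Pock iteration with parameters
`τ`, `σ`, `θ` (from the starting point `(x 0, y 0)`). -/
def IsChambollePock (f : H → EReal) (g : K → EReal) (L : H →L[ℝ] K) (τ σ θ : ℝ)
    (x : ℕ → H) (y : ℕ → K) : Prop :=
  ∀ k : ℕ,
    IsProx τ f (x k - τ • ContinuousLinearMap.adjoint L (y k)) (x (k + 1)) ∧
    IsProx σ (conjugate g) (y k + σ • L (x (k + 1) + θ • (x (k + 1) - x k))) (y (k + 1))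

end

end ChambollePock

namespace ChambollePock

/-! ### Convex functions, conjugates and subgradients -/

section ConvexAnalysis

variable {X : Type*} [NormedAddCommGroup X] [InnerProductSpace ℝ X]

/-! Each proximal step yields a subgradient inequality. Fix a KKT point and let `F`, `G` be the
primal and dual gaps, which are nonnegative. Four tests are combined: the new primal and dual
inequalities at the KKT point, the new primal inequality at the previous iterate, and the previous
primal inequality at the new iterate. With weights 1, 1, θ - 1/2, 1/2 they make `lyapunov` decrease
(`lyapunov_step`). The loss contains a quadratic form in the increments, and the step-size condition
is exactly what makes its scalar lower bound in the norms positive definite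
(`exists_dissipation_bound`).

`lyapunov` is coercive along the iteration (`le_lyapunov`), so the iterates are bounded, and the
increments and `F` tend to zero. It is not a distance: it also carries a cross term, a multiple of
`F` and a residual. All three vanish in the limit, the cross term being squeezed between the primal
and dual inequalities. Hence τ⁻¹‖x - x⋆‖² + σ⁻¹‖y - y⋆‖² converges for every KKT point.

Weak cluster points are KKT points (`saddle_inequality_of_weak_limit`): adding the primal and dual
inequalities cancels the term bilinear in both iterates, up to increments, and the rest passes to
the limit by weak lower semicontinuity. Opial's argument (`weak_limit_unique`) leaves a single
cluster point. Ultrafilters replace subsequences throughout. -/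

lemma IsConvex.sublevel {f : X → EReal} (hf : IsConvex f) (c : ℝ) :
    Convex ℝ {x | f x ≤ (c : EReal)} := by
  intro x hx y hy a b ha hb hab
  have hx' : f x ≤ (c : EReal) := hx
  have hy' : f y ≤ (c : EReal) := hy
  have h1 : (a : EReal) * f x ≤ ((a * c : ℝ) : EReal) := by
    rw [EReal.coe_mul]
    exact mul_le_mul_of_nonneg_left hx' (by exact_mod_cast ha)
  have h2 : (b : EReal) * f y ≤ ((b * c : ℝ) : EReal) := by
    rw [EReal.coe_mul]
    exact mul_le_mul_of_nonneg_left hy' (by exact_mod_cast hb)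
  have h3 := (hf x y a b ha hb hab).trans (add_le_add h1 h2)
  rwa [← EReal.coe_add, ← add_mul, hab, one_mul] at h3

lemma IsConvex.convex_epigraph {f : X → EReal} (hf : IsConvex f) :
    Convex ℝ {p : X × ℝ | f p.1 ≤ (p.2 : EReal)} := by
  intro p hp q hq a b ha hb hab
  have hp' : f p.1 ≤ (p.2 : EReal) := hp
  have hq' : f q.1 ≤ (q.2 : EReal) := hq
  have h1 : (a : EReal) * f p.1 ≤ ((a * p.2 : ℝ) : EReal) := by
    rw [EReal.coe_mul]
    exact mul_le_mul_of_nonneg_left hp' (by exact_mod_cast ha)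
  have h2 : (b : EReal) * f q.1 ≤ ((b * q.2 : ℝ) : EReal) := by
    rw [EReal.coe_mul]
    exact mul_le_mul_of_nonneg_left hq' (by exact_mod_cast hb)
  have h3 := (hf p.1 q.1 a b ha hb hab).trans (add_le_add h1 h2)
  rw [← EReal.coe_add] at h3
  simpa using h3

lemma isClosed_epigraph {X : Type*} [TopologicalSpace X] {f : X → EReal} (hf : LowerSemicontinuous f) :
    IsClosed {p : X × ℝ | f p.1 ≤ (p.2 : EReal)} := by
  have h : IsClosed {p : X × EReal | f p.1 ≤ p.2} := hf.isClosed_epigraph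
  exact h.preimage (continuous_fst.prodMk (continuous_coe_real_ereal.comp continuous_snd))

lemma IsProper.exists_coe {X : Type*} {f : X → EReal} (hf : IsProper f) : ∃ x, ∃ r : ℝ, f x = r := by
  obtain ⟨x, hx⟩ := hf.2
  exact ⟨x, (f x).toReal, (EReal.coe_toReal hx (hf.1 x)).symm⟩

/-- A proper convex lower semicontinuous function has a continuous affine minorant, i.e. its
conjugate is finite somewhere. -/
lemma ProperConvexLsc.exists_conjugate_ne_top [CompleteSpace X] {f : X → EReal}
    (hf : ProperConvexLsc f) : ∃ u, conjugate f u ≠ ⊤ := by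
  obtain ⟨v₀, r₀, hr₀⟩ := hf.proper.exists_coe
  have hmem : (v₀, r₀ - 1) ∉ {p : X × ℝ | f p.1 ≤ (p.2 : EReal)} := by
    simp only [Set.mem_ofPred_eq, hr₀, EReal.coe_le_coe_iff]
    linarith
  obtain ⟨φ, u, h1, h2⟩ := geometric_hahn_banach_point_closed hf.convex.convex_epigraph
    (isClosed_epigraph hf.lsc) hmem
  set ψ : X →L[ℝ] ℝ := φ.comp (ContinuousLinearMap.inl ℝ X ℝ)
  set s : ℝ := φ (0, 1)
  have hφ : ∀ (v : X) (r : ℝ), φ (v, r) = ψ v + r * s := by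
    intro v r
    have : (v, r) = (v, (0 : ℝ)) + r • ((0 : X), (1 : ℝ)) := by simp
    rw [this, map_add, map_smul]
    rfl
  have h3 := h2 (v₀, r₀) (by simp [hr₀])
  rw [hφ] at h1 h3
  -- Both points lie over `v₀`, so the separating hyperplane is not vertical and is the graph of an
  -- affine minorant.
  have hs : 0 < s := by linarith
  set w := (InnerProductSpace.toDual ℝ X).symm ψ
  have hw : ∀ v, inner ℝ w v = ψ v := fun v => InnerProductSpace.toDual_symm_apply
  refine ⟨-(s⁻¹ • w), ne_top_of_le_ne_top (EReal.coe_ne_top (-(s⁻¹ * u))) ?_⟩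
  refine iSup_le fun v => ?_
  by_cases hv : f v = ⊤
  · rw [hv]; simp
  · obtain ⟨r, hr⟩ : ∃ r : ℝ, f v = r := ⟨_, (EReal.coe_toReal hv (hf.proper.1 v)).symm⟩
    have h4 := h2 (v, r) (by simp [hr])
    rw [hφ] at h4
    rw [hr, ← EReal.coe_sub, EReal.coe_le_coe_iff, inner_neg_left, real_inner_smul_left, hw]
    have : s⁻¹ * u ≤ s⁻¹ * (ψ v + r * s) :=
      mul_le_mul_of_nonneg_left h4.le (inv_nonneg.2 hs.le)
    have h5 : s⁻¹ * (ψ v + r * s) = s⁻¹ * ψ v + r := by field_simp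
    linarith

lemma ProperConvexLsc.conjugate [CompleteSpace X] {f : X → EReal} (hf : ProperConvexLsc f) :
    ProperConvexLsc (conjugate f) where
  proper := by
    refine ⟨fun u => ?_, hf.exists_conjugate_ne_top⟩
    obtain ⟨v, r, hr⟩ := hf.proper.exists_coe
    have h : ((inner ℝ u v - r : ℝ) : EReal) ≤ ChambollePock.conjugate f u := by
      rw [EReal.coe_sub, ← hr]
      exact le_iSup (fun x : X => (((inner ℝ u x : ℝ) : EReal) - f x)) v
    exact ne_bot_of_le_ne_bot (EReal.coe_ne_bot _) h
  convex := by
    intro x y a b ha hb hab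
    refine iSup_le fun v => ?_
    by_cases hv : f v = ⊤
    · rw [hv]; simp
    · obtain ⟨r, hr⟩ : ∃ r : ℝ, f v = r := ⟨_, (EReal.coe_toReal hv (hf.proper.1 v)).symm⟩
      have h : ∀ u, ((inner ℝ u v - r : ℝ) : EReal) ≤ ChambollePock.conjugate f u := by
        intro u
        rw [EReal.coe_sub, ← hr]
        exact le_iSup (fun x : X => (((inner ℝ u x : ℝ) : EReal) - f x)) v
      have h1 := mul_le_mul_of_nonneg_left (h x) (show (0 : EReal) ≤ (a : EReal) by
        exact_mod_cast ha)
      have h2 := mul_le_mul_of_nonneg_left (h y) (show (0 : EReal) ≤ (b : EReal) by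
        exact_mod_cast hb)
      refine le_trans (le_of_eq ?_) (add_le_add h1 h2)
      rw [hr, ← EReal.coe_sub, ← EReal.coe_mul, ← EReal.coe_mul, ← EReal.coe_add,
        EReal.coe_eq_coe_iff, inner_add_left, real_inner_smul_left, real_inner_smul_left]
      linear_combination r * hab
  lsc := by
    refine lowerSemicontinuous_iSup fun v => ?_
    by_cases hv : f v = ⊤
    · simp only [hv, EReal.sub_top]
      exact lowerSemicontinuous_const
    · obtain ⟨r, hr⟩ : ∃ r : ℝ, f v = r := ⟨_, (EReal.coe_toReal hv (hf.proper.1 v)).symm⟩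
      simp only [hr, ← EReal.coe_sub]
      exact (continuous_coe_real_ereal.comp
        ((continuous_id.inner continuous_const).sub continuous_const)).lowerSemicontinuous

lemma ne_top_of_mem_subdifferential {f : X → EReal} (hf : IsProper f) {x u : X}
    (h : u ∈ subdifferential f x) : f x ≠ ⊤ := by
  intro hx
  obtain ⟨v, r, hr⟩ := hf.exists_coe
  have := h v
  rw [hx, hr] at this
  simp at this

lemma toReal_le_of_mem_subdifferential {f : X → EReal} (hf : IsProper f) {x u : X}
    (h : u ∈ subdifferential f x) {z : X} (hz : f z ≠ ⊤) :
    (f x).toReal + inner ℝ u (z - x) ≤ (f z).toReal := by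
  have := h z
  rw [← EReal.coe_toReal (ne_top_of_mem_subdifferential hf h) (hf.1 x),
    ← EReal.coe_toReal hz (hf.1 z)] at this
  exact_mod_cast this

lemma IsProx.ne_top {f : X → EReal} (hf : IsProper f) {τ : ℝ} {x p : X}
    (h : IsProx τ f x p) : f p ≠ ⊤ := by
  intro hp
  obtain ⟨v, r, hr⟩ := hf.exists_coe
  have := h v
  rw [hp, hr, ← EReal.coe_add, EReal.top_add_coe] at this
  exact EReal.coe_ne_top _ (top_le_iff.1 this)

/-! ### Proximal points and weak limits -/

lemma nonneg_of_forall_add_mul_nonneg {A B : ℝ}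
    (h : ∀ t : ℝ, 0 < t → t ≤ 1 → 0 ≤ A + t * B) : 0 ≤ A := by
  have hlim : Tendsto (fun t : ℝ => A + t * B) (𝓝[>] 0) (𝓝 (A + 0 * B)) :=
    ((continuous_const.add (continuous_id.mul continuous_const)).tendsto 0).mono_left
      nhdsWithin_le_nhds
  rw [zero_mul, add_zero] at hlim
  refine ge_of_tendsto hlim ?_
  filter_upwards [Ioc_mem_nhdsGT (zero_lt_one (α := ℝ))] with t ht
  exact h t ht.1 ht.2

/-- The optimality condition of the proximal operator. -/
lemma IsProx.mem_subdifferential {f : X → EReal} (hf : IsProper f) (hc : IsConvex f)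
    {τ : ℝ} {x p : X} (h : IsProx τ f x p) :
    τ⁻¹ • (x - p) ∈ subdifferential f p := by
  intro z
  by_cases hz : f z = ⊤
  · rw [hz]; exact le_top
  obtain ⟨r, hr⟩ : ∃ r : ℝ, f z = r := ⟨_, (EReal.coe_toReal hz (hf.1 z)).symm⟩
  obtain ⟨s, hs⟩ : ∃ s : ℝ, f p = s := ⟨_, (EReal.coe_toReal (h.ne_top hf) (hf.1 p)).symm⟩
  rw [hr, hs, ← EReal.coe_add, EReal.coe_le_coe_iff]
  suffices 0 ≤ r - s - inner ℝ (τ⁻¹ • (x - p)) (z - p) by linarith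
  -- Compare `p` with `p + t(z - p)`, divide by `t` and let `t` tend to 0; `B` is the second-order
  -- term.
  refine nonneg_of_forall_add_mul_nonneg (B := 1 / (2 * τ) * ‖z - p‖ ^ 2) fun t ht ht1 => ?_
  have h1 := hc p z (1 - t) t (by linarith) ht.le (by ring)
  rw [hs, hr, ← EReal.coe_mul, ← EReal.coe_mul, ← EReal.coe_add] at h1
  have h2 := (h ((1 - t) • p + t • z)).trans (add_le_add_left h1 _)
  rw [hs, ← EReal.coe_add, ← EReal.coe_add, EReal.coe_le_coe_iff] at h2
  have h3 : (1 - t) • p + t • z - x = t • (z - p) - (x - p) := by module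
  have h4 : ‖p - x‖ = ‖x - p‖ := norm_sub_rev _ _
  rw [h3, h4, norm_sub_sq_real (t • (z - p)), norm_smul, real_inner_smul_left,
    real_inner_comm, mul_pow, Real.norm_eq_abs, sq_abs] at h2
  rw [real_inner_smul_left]
  have h5 : 1 / (2 * τ) = τ⁻¹ / 2 := by rw [one_div, mul_inv]; ring
  rw [h5] at h2 ⊢
  refine nonneg_of_mul_nonneg_right (a := t) ?_ ht
  nlinarith [h2]

/-- Convex lower semicontinuous functions are lower semicontinuous along weakly convergent
families. -/
lemma ProperConvexLsc.eventually_lt [CompleteSpace X] {f : X → EReal} (hf : ProperConvexLsc f)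
    {ι : Type*} {l : Filter ι} {p : ι → X} {q : X}
    (hp : ∀ z, Tendsto (fun i => (inner ℝ z (p i) : ℝ)) l (𝓝 (inner ℝ z q)))
    {c : ℝ} (hc : (c : EReal) < f q) : ∀ᶠ i in l, (c : EReal) < f (p i) := by
  have hcl : IsClosed {x | f x ≤ (c : EReal)} := hf.lsc.isClosed_preimage c
  -- A functional separating `q` from the closed convex sublevel set keeps the family out of that
  -- set eventually.
  obtain ⟨φ, u, h1, h2⟩ := geometric_hahn_banach_point_closed (hf.convex.sublevel c) hcl
    (x := q) (by simpa using hc)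
  set w := (InnerProductSpace.toDual ℝ X).symm φ
  have hw : ∀ v, inner ℝ w v = φ v := fun v => InnerProductSpace.toDual_symm_apply
  have h3 := hp w
  simp only [hw] at h3
  filter_upwards [h3.eventually_lt_const h1] with i hi
  by_contra hcon
  exact lt_asymm hi (h2 _ (not_lt.1 hcon))

/-- Bounded families in a Hilbert space converge weakly along ultrafilters. -/
lemma exists_weak_limit [CompleteSpace X] {ι : Type*} (l : Ultrafilter ι) {p : ι → X} {C : ℝ}
    (hC : ∀ᶠ i in (l : Filter ι), ‖p i‖ ≤ C) :
    ∃ q, ∀ z, Tendsto (fun i => (inner ℝ z (p i) : ℝ)) l (𝓝 (inner ℝ z q)) := by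
  have hb : ∀ z : X, ∀ᶠ i in (l : Filter ι), |(inner ℝ z (p i) : ℝ)| ≤ ‖z‖ * C := by
    intro z
    filter_upwards [hC] with i hi
    exact (abs_real_inner_le_norm _ _).trans (mul_le_mul_of_nonneg_left hi (norm_nonneg _))
  have hlim : ∀ z : X, ∃ r, Tendsto (fun i => (inner ℝ z (p i) : ℝ)) l (𝓝 r) := by
    intro z
    have hK : IsCompact (Set.Icc (-(‖z‖ * C)) (‖z‖ * C)) := isCompact_Icc
    obtain ⟨r, -, hr⟩ := hK.ultrafilter_le_nhds (l.map fun i => (inner ℝ z (p i) : ℝ)) (by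
      rw [le_principal_iff, Ultrafilter.coe_map, mem_map]
      filter_upwards [hb z] with i hi
      exact abs_le.1 hi)
    exact ⟨r, hr⟩
  choose φ hφ using hlim
  let Φ : X →ₗ[ℝ] ℝ :=
    { toFun := φ
      map_add' := fun x y => by
        refine tendsto_nhds_unique (hφ (x + y)) ?_
        simpa only [inner_add_left] using (hφ x).add (hφ y)
      map_smul' := fun a x => by
        refine tendsto_nhds_unique (hφ (a • x)) ?_
        simpa only [real_inner_smul_left, smul_eq_mul, RingHom.id_apply] using (hφ x).const_mul a }
  let Ψ : X →L[ℝ] ℝ := Φ.mkContinuous C fun z => by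
    refine le_of_tendsto (hφ z).norm ?_
    filter_upwards [hb z] with i hi
    rw [mul_comm]; exact hi
  refine ⟨(InnerProductSpace.toDual ℝ X).symm Ψ, fun z => ?_⟩
  have : inner ℝ z ((InnerProductSpace.toDual ℝ X).symm Ψ) = φ z := by
    rw [real_inner_comm, InnerProductSpace.toDual_symm_apply]; rfl
  rw [this]
  exact hφ z

end ConvexAnalysis

/-! ### Lyapunov function and its quadratic forms -/

section Lyapunov

/-- With ε the determinant over the trace, (A - ε)(B - ε) = C²/4 + ε², so the form stays nonnegative
after subtracting ε(s² + t²). -/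
lemma exists_pos_mul_le_quadratic {A B C : ℝ} (hA : 0 < A) (hB : 0 < B) (h : C ^ 2 < 4 * A * B) :
    ∃ ε > 0, ∀ s t : ℝ, ε * (s ^ 2 + t ^ 2) ≤ A * s ^ 2 + B * t ^ 2 - C * (s * t) := by
  obtain ⟨ε, hε⟩ : ∃ ε, ε = (A * B - C ^ 2 / 4) / (A + B) := ⟨_, rfl⟩
  have hAB : 0 < A + B := by positivity
  have hε0 : 0 < ε := by rw [hε]; exact div_pos (by linarith) hAB
  have hmul : ε * (A + B) = A * B - C ^ 2 / 4 := by rw [hε]; field_simp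
  have hεA : ε < A := by
    rw [hε, div_lt_iff₀ hAB]
    nlinarith [sq_nonneg C]
  refine ⟨ε, hε0, fun s t => ?_⟩
  have key : 0 ≤ (A - ε) * ((A - ε) * s ^ 2 + (B - ε) * t ^ 2 - C * (s * t)) := by
    have : (A - ε) * ((A - ε) * s ^ 2 + (B - ε) * t ^ 2 - C * (s * t))
        = ((A - ε) * s - C / 2 * t) ^ 2 + (ε * t) ^ 2 := by
      linear_combination (-(t ^ 2)) * hmul
    rw [this]; positivity
  have := nonneg_of_mul_nonneg_right key (sub_pos.2 hεA)
  linarith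

/-- A sequence that decreases by at least `d n` in each step, and is bounded below, converges, and
`d` tends to zero. -/
lemma tendsto_of_add_le {V d : ℕ → ℝ} (hV : ∀ n, 0 ≤ V n) (hd : ∀ n, 0 ≤ d n)
    (h : ∀ n, V (n + 1) + d n ≤ V n) :
    (∃ v, Tendsto V atTop (𝓝 v)) ∧ Tendsto d atTop (𝓝 0) ∧ ∀ n, V n ≤ V 0 := by
  have hanti : Antitone V := antitone_nat_of_succ_le fun n => by linarith [h n, hd n]
  have hlim : Tendsto V atTop (𝓝 (⨅ n, V n)) :=
    tendsto_atTop_ciInf hanti ⟨0, by rintro _ ⟨n, rfl⟩; exact hV n⟩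
  refine ⟨⟨_, hlim⟩, ?_, fun n => hanti (Nat.zero_le n)⟩
  have hdiff : Tendsto (fun n => V n - V (n + 1)) atTop (𝓝 0) := by
    simpa using hlim.sub (hlim.comp (tendsto_add_atTop_nat 1))
  exact squeeze_zero hd (fun n => by linarith [h n]) hdiff

variable {H : Type*} [NormedAddCommGroup H] [InnerProductSpace ℝ H] [CompleteSpace H]
  {K : Type*} [NormedAddCommGroup K] [InnerProductSpace ℝ K] [CompleteSpace K]

local postfix:max "†" => ContinuousLinearMap.adjoint

lemma norm_adjoint_apply_sq_le (L : H →L[ℝ] K) (b : K) :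
    ‖(L†) b‖ ^ 2 ≤ ‖L‖ ^ 2 * ‖b‖ ^ 2 := by
  rw [← mul_pow]
  refine pow_le_pow_left₀ (norm_nonneg _) ?_ 2
  simpa using (L†).le_opNorm b

lemma inner_adjoint_le (L : H →L[ℝ] K) (a : H) (b : K) :
    inner ℝ a ((L†) b) ≤ ‖L‖ * (‖a‖ * ‖b‖) := by
  have h1 := real_inner_le_norm a ((L†) b)
  have h2 : ‖(L†) b‖ ≤ ‖L‖ * ‖b‖ := by simpa using (L†).le_opNorm b
  nlinarith [norm_nonneg a]

/-- Bounding by ‖L‖ leaves a binary form in ‖a‖, ‖b‖ for which 4AB - C² is a positive multiple of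
4σ⁻¹ - τ‖L‖²(1 + 2θ). This is where the full step-size condition is used. -/
lemma exists_dissipation_bound (L : H →L[ℝ] K) {τ σ θ : ℝ} (hτ : 0 < τ) (hσ : 0 < σ)
    (hθ : 1 / 2 < θ) (hstep : τ * σ * ‖L‖ ^ 2 < 4 / (1 + 2 * θ)) :
    ∃ ε > 0, ∀ (a : H) (b : K), ε * (‖a‖ ^ 2 + ‖b‖ ^ 2) ≤
      (θ - 1 / 2) * τ⁻¹ * ‖a‖ ^ 2 + σ⁻¹ / 2 * ‖b‖ ^ 2 - τ / 4 * ‖(L†) b‖ ^ 2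
        - (θ - 1 / 2) * inner ℝ a ((L†) b) := by
  have hτi : τ * τ⁻¹ = 1 := mul_inv_cancel₀ hτ.ne'
  have hσi : σ * σ⁻¹ = 1 := mul_inv_cancel₀ hσ.ne'
  have hθ' : 0 < θ - 1 / 2 := by linarith
  rw [lt_div_iff₀ (by linarith)] at hstep
  have hstep' : τ * ‖L‖ ^ 2 * (1 + 2 * θ) < 4 * σ⁻¹ := by
    have := mul_lt_mul_of_pos_right hstep (inv_pos.2 hσ)
    calc _ = τ * σ * ‖L‖ ^ 2 * (1 + 2 * θ) * σ⁻¹ := by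
          linear_combination (-(τ * ‖L‖ ^ 2 * (1 + 2 * θ))) * hσi
      _ < _ := this
  have hn : 0 ≤ τ * ‖L‖ ^ 2 := by positivity
  have hB : 0 < σ⁻¹ / 2 - τ / 4 * ‖L‖ ^ 2 := by nlinarith
  have hA : 0 < (θ - 1 / 2) * τ⁻¹ := mul_pos hθ' (inv_pos.2 hτ)
  obtain ⟨ε, hε, h⟩ := exists_pos_mul_le_quadratic (C := (θ - 1 / 2) * ‖L‖) hA hB (by
    have e : 4 * ((θ - 1 / 2) * τ⁻¹) * (σ⁻¹ / 2 - τ / 4 * ‖L‖ ^ 2) - ((θ - 1 / 2) * ‖L‖) ^ 2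
        = (θ - 1 / 2) * τ⁻¹ * ((4 * σ⁻¹ - τ * ‖L‖ ^ 2 * (1 + 2 * θ)) / 2) := by
      linear_combination ((θ - 1 / 2) * (θ - 1 / 2) * ‖L‖ ^ 2) * hτi
    have : 0 < (θ - 1 / 2) * τ⁻¹ * ((4 * σ⁻¹ - τ * ‖L‖ ^ 2 * (1 + 2 * θ)) / 2) :=
      mul_pos hA (by linarith)
    linarith)
  refine ⟨ε, hε, fun a b => (h ‖a‖ ‖b‖).trans ?_⟩
  have h1 := mul_le_mul_of_nonneg_left (norm_adjoint_apply_sq_le L b) (by positivity : 0 ≤ τ / 4)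
  have h2 := mul_le_mul_of_nonneg_left (inner_adjoint_le L a b) hθ'.le
  linarith

/-- Only τσ‖L‖² < 2 is needed, which follows because θ > 1/2. -/
lemma exists_coercivity_bound (L : H →L[ℝ] K) {τ σ θ : ℝ} (hτ : 0 < τ) (hσ : 0 < σ)
    (hθ : 1 / 2 < θ) (hstep : τ * σ * ‖L‖ ^ 2 < 4 / (1 + 2 * θ)) :
    ∃ ε > 0, ∀ (a : H) (b : K), ε * (‖a‖ ^ 2 + ‖b‖ ^ 2) ≤
      τ⁻¹ / 4 * ‖a‖ ^ 2 + σ⁻¹ / 2 * ‖b‖ ^ 2 - 1 / 2 * inner ℝ a ((L†) b) := by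
  have h2 : τ * σ * ‖L‖ ^ 2 < 2 :=
    hstep.trans (by rw [div_lt_iff₀ (by linarith)]; linarith)
  have hp : 0 < τ⁻¹ * σ⁻¹ := by positivity
  have h3 : ‖L‖ ^ 2 < 2 * (τ⁻¹ * σ⁻¹) := by
    have := mul_lt_mul_of_pos_right h2 hp
    calc _ = τ * σ * ‖L‖ ^ 2 * (τ⁻¹ * σ⁻¹) := by field_simp
      _ < _ := this
  obtain ⟨ε, hε, h⟩ := exists_pos_mul_le_quadratic (A := τ⁻¹ / 4) (B := σ⁻¹ / 2)
    (C := 1 / 2 * ‖L‖) (by positivity) (by positivity) (by nlinarith)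
  refine ⟨ε, hε, fun a b => (h ‖a‖ ‖b‖).trans ?_⟩
  have := inner_adjoint_le L a b
  linarith

/-- The Lyapunov function, for the two consecutive iterates `(x₀, y₀)` and `(x₁, y₁)`, relative
to a solution located at the origin; `φ` is the gap of the primal function at `x₁`. -/
noncomputable def lyapunov (L : H →L[ℝ] K) (τ σ θ φ : ℝ) (x₀ x₁ : H) (y₀ y₁ : K) : ℝ :=
  τ⁻¹ / 2 * ‖x₁‖ ^ 2 + σ⁻¹ / 2 * ‖y₁‖ ^ 2 - inner ℝ x₁ ((L†) y₁) + (θ - 1) * φ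
    + τ⁻¹ / 4 * ‖x₁ - x₀ - τ • (L†) (y₁ - y₀)‖ ^ 2

/-- The term (θ - 1)φ may be negative. Adding half of `h` turns it into (θ - 1/2)φ ≥ 0 and completes
the residual to a square with `x₁`, at the cost of τ⁻¹/4 ‖x₁‖². -/
lemma le_lyapunov (L : H →L[ℝ] K) {τ σ θ φ : ℝ} (hτ : 0 < τ) (hθ : 1 / 2 < θ)
    {x₀ x₁ : H} {y₀ y₁ : K} (hφ : 0 ≤ φ)
    (h : φ + τ⁻¹ * inner ℝ (x₁ - x₀) x₁ + inner ℝ x₁ ((L†) y₀) ≤ 0) :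
    τ⁻¹ / 4 * ‖x₁‖ ^ 2 + σ⁻¹ / 2 * ‖y₁‖ ^ 2 - 1 / 2 * inner ℝ x₁ ((L†) y₁)
      ≤ lyapunov L τ σ θ φ x₀ x₁ y₀ y₁ := by
  have hτi : τ⁻¹ * τ = 1 := inv_mul_cancel₀ hτ.ne'
  have h1 : 0 ≤ τ⁻¹ / 4 * ‖(x₁ - x₀ - τ • (L†) (y₁ - y₀)) + x₁‖ ^ 2 := by positivity
  rw [norm_add_sq_real] at h1
  have h2 : 0 ≤ (θ - 1 / 2) * φ := mul_nonneg (by linarith) hφ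
  have e : τ⁻¹ * inner ℝ (x₁ - x₀ - τ • (L†) (y₁ - y₀)) x₁
      = τ⁻¹ * inner ℝ (x₁ - x₀) x₁ - inner ℝ x₁ ((L†) y₁) + inner ℝ x₁ ((L†) y₀) := by
    rw [real_inner_comm, inner_sub_right, real_inner_smul_right, map_sub,
      inner_sub_right x₁ ((L†) y₁), real_inner_comm x₁ (x₁ - x₀)]
    linear_combination (-inner ℝ x₁ ((L†) y₁) + inner ℝ x₁ ((L†) y₀)) * hτi
  unfold lyapunov
  linarith

/-- The sum `ha` + `hb` + (θ - 1/2) `hc` + 1/2 `hd`; the gaps then combine to φ₂ + γ₂ + (θ - 1)(φ₂ -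
φ₁). -/
lemma lyapunov_step (L : H →L[ℝ] K) {τ σ θ φ₁ φ₂ γ₂ : ℝ} (hτ : 0 < τ) (hθ : 1 / 2 < θ)
    {x₀ x₁ x₂ : H} {y₀ y₁ y₂ : K}
    (ha : φ₂ + τ⁻¹ * inner ℝ (x₂ - x₁) x₂ + inner ℝ x₂ ((L†) y₁) ≤ 0)
    (hb : γ₂ + σ⁻¹ * inner ℝ (y₂ - y₁) y₂ - inner ℝ (x₂ + θ • (x₂ - x₁)) ((L†) y₂) ≤ 0)
    (hc : φ₂ - φ₁ + τ⁻¹ * ‖x₂ - x₁‖ ^ 2 + inner ℝ (x₂ - x₁) ((L†) y₁) ≤ 0)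
    (hd : φ₁ - φ₂ - τ⁻¹ * inner ℝ (x₁ - x₀) (x₂ - x₁) - inner ℝ (x₂ - x₁) ((L†) y₀) ≤ 0) :
    lyapunov L τ σ θ φ₂ x₁ x₂ y₁ y₂ + (φ₂ + γ₂
      + ((θ - 1 / 2) * τ⁻¹ * ‖x₂ - x₁‖ ^ 2 + σ⁻¹ / 2 * ‖y₂ - y₁‖ ^ 2
        - τ / 4 * ‖(L†) (y₂ - y₁)‖ ^ 2 - (θ - 1 / 2) * inner ℝ (x₂ - x₁) ((L†) (y₂ - y₁))))
      ≤ lyapunov L τ σ θ φ₁ x₀ x₁ y₀ y₁ := by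
  have hτi : τ⁻¹ * τ = 1 := inv_mul_cancel₀ hτ.ne'
  have hc' := mul_nonpos_of_nonneg_of_nonpos (by linarith : 0 ≤ θ - 1 / 2) hc
  obtain ⟨e, he⟩ : ∃ e, e = x₁ - x₀ - τ • (L†) (y₁ - y₀) := ⟨_, rfl⟩
  -- Young's inequality for the product of `x₂ - x₁` with the old residual `e`, which half of `hd`
  -- produces.
  have hsq : 0 ≤ τ⁻¹ / 4 * ‖(x₂ - x₁) - e‖ ^ 2 := by positivity
  rw [norm_sub_sq_real] at hsq
  have e1 : τ⁻¹ * inner ℝ (x₂ - x₁) e = τ⁻¹ * inner ℝ (x₁ - x₀) (x₂ - x₁)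
      - inner ℝ (x₂ - x₁) ((L†) y₁) + inner ℝ (x₂ - x₁) ((L†) y₀) := by
    rw [he, inner_sub_right, real_inner_smul_right, map_sub, inner_sub_right _ ((L†) y₁),
      real_inner_comm (x₁ - x₀)]
    linear_combination
      (-inner ℝ (x₂ - x₁) ((L†) y₁) + inner ℝ (x₂ - x₁) ((L†) y₀)) * hτi
  have e2 : τ⁻¹ / 4 * ‖x₂ - x₁ - τ • (L†) (y₂ - y₁)‖ ^ 2 = τ⁻¹ / 4 * ‖x₂ - x₁‖ ^ 2
      - 1 / 2 * inner ℝ (x₂ - x₁) ((L†) (y₂ - y₁)) + τ / 4 * ‖(L†) (y₂ - y₁)‖ ^ 2 := by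
    rw [norm_sub_sq_real, real_inner_smul_right, norm_smul, Real.norm_eq_abs, mul_pow, sq_abs]
    linear_combination (-1 / 2 * inner ℝ (x₂ - x₁) ((L†) (y₂ - y₁))
      + τ / 4 * ‖(L†) (y₂ - y₁)‖ ^ 2) * hτi
  have e3 : ‖x₁‖ ^ 2 = ‖x₂‖ ^ 2 - 2 * inner ℝ (x₂ - x₁) x₂ + ‖x₂ - x₁‖ ^ 2 := by
    have := norm_sub_sq_real x₂ (x₂ - x₁)
    rwa [sub_sub_cancel, real_inner_comm] at this
  have e4 : ‖y₁‖ ^ 2 = ‖y₂‖ ^ 2 - 2 * inner ℝ (y₂ - y₁) y₂ + ‖y₂ - y₁‖ ^ 2 := by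
    have := norm_sub_sq_real y₂ (y₂ - y₁)
    rwa [sub_sub_cancel, real_inner_comm] at this
  unfold lyapunov
  rw [e2, e3, e4, ← he]
  simp only [map_sub, inner_sub_left, inner_sub_right, inner_add_left, real_inner_smul_left]
    at ha hb hc' hd e1 hsq ⊢
  linarith

end Lyapunov

/-! ### Asymptotics of the iterates -/

section Convergence

variable {H : Type*} [NormedAddCommGroup H] [InnerProductSpace ℝ H] [CompleteSpace H]
  {K : Type*} [NormedAddCommGroup K] [InnerProductSpace ℝ K] [CompleteSpace K]

local postfix:max "†" => ContinuousLinearMap.adjoint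

lemma tendsto_zero_of_mul_norm_sq_le {E : Type*} [NormedAddCommGroup E] {v : ℕ → E} {d : ℕ → ℝ}
    {ε : ℝ} (hε : 0 < ε) (hd : Tendsto d atTop (𝓝 0)) (h : ∀ n, ε * ‖v n‖ ^ 2 ≤ d n) :
    Tendsto v atTop (𝓝 0) := by
  have h1 : Tendsto (fun n => ‖v n‖ ^ 2) atTop (𝓝 0) := by
    refine squeeze_zero (fun n => by positivity) (fun n => ?_)
      (by simpa using hd.const_mul ε⁻¹)
    rw [← div_eq_inv_mul, le_div_iff₀' hε]
    exact h n
  have h2 := h1.sqrt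
  simp only [Real.sqrt_sq (norm_nonneg _), Real.sqrt_zero] at h2
  exact tendsto_zero_iff_norm_tendsto_zero.2 h2

/-- Asymptotics of the iteration when the solution is located at the origin. The primal and dual
gaps of the `n`-th iterate are `F n` and `G n`. -/
lemma asymptotics_of_gap_inequalities (L : H →L[ℝ] K) {τ σ θ : ℝ} (hτ : 0 < τ) (hσ : 0 < σ)
    (hθ : 1 / 2 < θ) (hstep : τ * σ * ‖L‖ ^ 2 < 4 / (1 + 2 * θ))
    {x : ℕ → H} {y : ℕ → K} {F G : ℕ → ℝ} (hF : ∀ n, 0 ≤ F (n + 1)) (hG : ∀ n, 0 ≤ G (n + 1))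
    (ha : ∀ n, F (n + 1) + τ⁻¹ * inner ℝ (x (n + 1) - x n) (x (n + 1))
      + inner ℝ (x (n + 1)) ((L†) (y n)) ≤ 0)
    (hb : ∀ n, G (n + 1) + σ⁻¹ * inner ℝ (y (n + 1) - y n) (y (n + 1))
      - inner ℝ (x (n + 1) + θ • (x (n + 1) - x n)) ((L†) (y (n + 1))) ≤ 0)
    (hc : ∀ n, F (n + 2) - F (n + 1) + τ⁻¹ * ‖x (n + 2) - x (n + 1)‖ ^ 2
      + inner ℝ (x (n + 2) - x (n + 1)) ((L†) (y (n + 1))) ≤ 0)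
    (hd : ∀ n, F (n + 1) - F (n + 2) - τ⁻¹ * inner ℝ (x (n + 1) - x n) (x (n + 2) - x (n + 1))
      - inner ℝ (x (n + 2) - x (n + 1)) ((L†) (y n)) ≤ 0) :
    (∃ C, ∀ n, ‖x (n + 1)‖ ≤ C ∧ ‖y (n + 1)‖ ≤ C) ∧
    Tendsto (fun n => x (n + 1) - x n) atTop (𝓝 0) ∧
    Tendsto (fun n => y (n + 1) - y n) atTop (𝓝 0) ∧
    Tendsto (fun n => (inner ℝ (x n) ((L†) (y n)) : ℝ)) atTop (𝓝 0) ∧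
    ∃ v, Tendsto (fun n => τ⁻¹ * ‖x n‖ ^ 2 + σ⁻¹ * ‖y n‖ ^ 2) atTop (𝓝 v) := by
  obtain ⟨ε, hε, hdis⟩ := exists_dissipation_bound L hτ hσ hθ hstep
  obtain ⟨δ, hδ, hcoe⟩ := exists_coercivity_bound L hτ hσ hθ hstep
  set V : ℕ → ℝ := fun n => lyapunov L τ σ θ (F (n + 1)) (x n) (x (n + 1)) (y n) (y (n + 1))
    with hVdef
  set d : ℕ → ℝ := fun n => F (n + 2) + G (n + 2)
    + ε * (‖x (n + 2) - x (n + 1)‖ ^ 2 + ‖y (n + 2) - y (n + 1)‖ ^ 2) with hddef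
  have hVlow : ∀ n, δ * (‖x (n + 1)‖ ^ 2 + ‖y (n + 1)‖ ^ 2) ≤ V n := fun n =>
    (hcoe _ _).trans (le_lyapunov L hτ hθ (hF n) (ha n))
  have hdec : ∀ n, V (n + 1) + d n ≤ V n := by
    intro n
    have h1 := lyapunov_step L hτ hθ (ha (n + 1)) (hb (n + 1)) (hc n) (hd n)
    have h2 := hdis (x (n + 2) - x (n + 1)) (y (n + 2) - y (n + 1))
    refine le_trans ?_ h1
    simp only [hVdef, hddef]
    gcongr
  have hsq : ∀ n, 0 ≤ ε * (‖x (n + 2) - x (n + 1)‖ ^ 2 + ‖y (n + 2) - y (n + 1)‖ ^ 2) :=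
    fun n => by positivity
  have hd0 : ∀ n, 0 ≤ d n := fun n => by
    have := hF (n + 1); have := hG (n + 1); have := hsq n
    simp only [hddef]; linarith
  obtain ⟨⟨v, hv⟩, hdlim, hVle⟩ := tendsto_of_add_le
    (fun n => le_trans (by positivity) (hVlow n)) hd0 hdec
  have hdx : Tendsto (fun n => x (n + 1) - x n) atTop (𝓝 0) := by
    rw [← tendsto_add_atTop_iff_nat 1]
    refine tendsto_zero_of_mul_norm_sq_le hε hdlim fun n => ?_
    have := hF (n + 1); have := hG (n + 1)
    have : 0 ≤ ε * ‖y (n + 2) - y (n + 1)‖ ^ 2 := by positivity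
    simp only [hddef]; linarith
  have hdy : Tendsto (fun n => y (n + 1) - y n) atTop (𝓝 0) := by
    rw [← tendsto_add_atTop_iff_nat 1]
    refine tendsto_zero_of_mul_norm_sq_le hε hdlim fun n => ?_
    have := hF (n + 1); have := hG (n + 1)
    have : 0 ≤ ε * ‖x (n + 2) - x (n + 1)‖ ^ 2 := by positivity
    simp only [hddef]; linarith
  have hFlim : Tendsto (fun n => F (n + 1)) atTop (𝓝 0) := by
    rw [← tendsto_add_atTop_iff_nat 1]
    refine squeeze_zero (fun n => hF (n + 1)) (fun n => ?_) hdlim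
    have := hG (n + 1); have := hsq n
    simp only [hddef]; linarith
  have hbdd : ∃ C, ∀ n, ‖x (n + 1)‖ ≤ C ∧ ‖y (n + 1)‖ ≤ C := by
    refine ⟨√(V 0 / δ), fun n => ?_⟩
    have h1 : ‖x (n + 1)‖ ^ 2 + ‖y (n + 1)‖ ^ 2 ≤ V 0 / δ := by
      rw [le_div_iff₀' hδ]
      exact (hVlow n).trans (hVle n)
    exact ⟨Real.le_sqrt_of_sq_le (by nlinarith [sq_nonneg ‖y (n + 1)‖]),
      Real.le_sqrt_of_sq_le (by nlinarith [sq_nonneg ‖x (n + 1)‖])⟩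
  obtain ⟨C, hC⟩ := hbdd
  have hC0 : 0 ≤ C := (norm_nonneg _).trans (hC 0).1
  -- `ha` bounds the cross term above and `hb` below, in both cases by increments times bounded
  -- quantities, once the nonnegative gaps are dropped.
  have hinner : Tendsto (fun n => (inner ℝ (x (n + 1)) ((L†) (y (n + 1))) : ℝ)) atTop (𝓝 0) := by
    have hup : Tendsto (fun n => τ⁻¹ * (‖x (n + 1) - x n‖ * C)
        + ‖L‖ * (C * ‖y (n + 1) - y n‖)) atTop (𝓝 0) := by
      have := ((hdx.norm.mul_const C).const_mul τ⁻¹).add ((hdy.norm.const_mul C).const_mul ‖L‖)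
      simpa using this
    have hlo : Tendsto (fun n => -(σ⁻¹ * (‖y (n + 1) - y n‖ * C)
        + θ * (‖L‖ * (‖x (n + 1) - x n‖ * C)))) atTop (𝓝 0) := by
      have := (((hdy.norm.mul_const C).const_mul σ⁻¹).add
        (((hdx.norm.mul_const C).const_mul ‖L‖).const_mul θ)).neg
      simpa using this
    refine tendsto_of_tendsto_of_tendsto_of_le_of_le hlo hup (fun n => ?_) (fun n => ?_)
    · have h1 := hb n
      have h2 : -(‖y (n + 1) - y n‖ * C) ≤ inner ℝ (y (n + 1) - y n) (y (n + 1)) := by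
        have := neg_le_of_abs_le (abs_real_inner_le_norm (y (n + 1) - y n) (y (n + 1)))
        have := mul_le_mul_of_nonneg_left (hC n).2 (norm_nonneg (y (n + 1) - y n))
        linarith
      have h3 : inner ℝ (x (n + 1) - x n) ((L†) (y (n + 1))) ≤ ‖L‖ * (‖x (n + 1) - x n‖ * C) := by
        refine (inner_adjoint_le L _ _).trans ?_
        gcongr
        exact (hC n).2
      rw [inner_add_left, real_inner_smul_left] at h1
      have h4 := mul_le_mul_of_nonneg_left h2 (inv_nonneg.2 hσ.le)
      have h5 := mul_le_mul_of_nonneg_left h3 (by linarith : 0 ≤ θ)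
      have := hG n
      dsimp only
      linarith
    · have h1 := ha n
      have h2 : -(‖x (n + 1) - x n‖ * C) ≤ inner ℝ (x (n + 1) - x n) (x (n + 1)) := by
        have := neg_le_of_abs_le (abs_real_inner_le_norm (x (n + 1) - x n) (x (n + 1)))
        have := mul_le_mul_of_nonneg_left (hC n).1 (norm_nonneg (x (n + 1) - x n))
        linarith
      have h3 : inner ℝ (x (n + 1)) ((L†) (y (n + 1) - y n)) ≤ ‖L‖ * (C * ‖y (n + 1) - y n‖) := by
        refine (inner_adjoint_le L _ _).trans ?_
        gcongr
        exact (hC n).1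
      rw [map_sub, inner_sub_right] at h3
      have h4 := mul_le_mul_of_nonneg_left h2 (inv_nonneg.2 hτ.le)
      have := hF n
      dsimp only
      linarith
  refine ⟨⟨C, hC⟩, hdx, hdy, (tendsto_add_atTop_iff_nat 1).1 hinner, 2 * v, ?_⟩
  rw [← tendsto_add_atTop_iff_nat 1]
  have he : Tendsto (fun n => τ⁻¹ / 4 *
      ‖x (n + 1) - x n - τ • (L†) (y (n + 1) - y n)‖ ^ 2) atTop (𝓝 0) := by
    have h1 : Tendsto (fun n => (L†) (y (n + 1) - y n)) atTop (𝓝 0) := by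
      have := ((L†).continuous.tendsto 0).comp hdy
      rwa [map_zero] at this
    have := ((hdx.sub (h1.const_smul τ)).norm.pow 2).const_mul (τ⁻¹ / 4)
    simpa using this
  -- Twice the Lyapunov function, stripped of its vanishing terms, is the weighted squared distance.
  have hlim := (((hv.add hinner).sub (hFlim.const_mul (θ - 1))).sub he).const_mul 2
  simp only [add_zero, mul_zero, sub_zero] at hlim
  refine hlim.congr fun n => ?_
  simp only [hVdef, lyapunov]
  ring

/-- Asymptotics of the iteration relative to a saddle point `(xs, ys)`; the functions are real
valued on their domains `D` and `E`. -/
lemma asymptotics_of_subgradient_inequalities (L : H →L[ℝ] K) {τ σ θ : ℝ} (hτ : 0 < τ)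
    (hσ : 0 < σ) (hθ : 1 / 2 < θ) (hstep : τ * σ * ‖L‖ ^ 2 < 4 / (1 + 2 * θ))
    {x : ℕ → H} {y : ℕ → K} {φ : H → ℝ} {γ : K → ℝ} {D : Set H} {E : Set K} {xs : H} {ys : K}
    (hxD : ∀ n, x (n + 1) ∈ D) (hyE : ∀ n, y (n + 1) ∈ E) (hxs : xs ∈ D) (hys : ys ∈ E)
    (hP : ∀ n, ∀ z ∈ D, φ (x (n + 1)) + τ⁻¹ * inner ℝ (x n - x (n + 1)) (z - x (n + 1))
      - inner ℝ (z - x (n + 1)) ((L†) (y n)) ≤ φ z)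
    (hQ : ∀ n, ∀ w ∈ E, γ (y (n + 1)) + σ⁻¹ * inner ℝ (y n - y (n + 1)) (w - y (n + 1))
      + inner ℝ (x (n + 1) + θ • (x (n + 1) - x n)) ((L†) (w - y (n + 1))) ≤ γ w)
    (hsP : ∀ z ∈ D, φ xs - inner ℝ (z - xs) ((L†) ys) ≤ φ z)
    (hsQ : ∀ w ∈ E, γ ys + inner ℝ xs ((L†) (w - ys)) ≤ γ w) :
    (∃ C, ∀ n, ‖x (n + 1) - xs‖ ≤ C ∧ ‖y (n + 1) - ys‖ ≤ C) ∧
    Tendsto (fun n => x (n + 1) - x n) atTop (𝓝 0) ∧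
    Tendsto (fun n => y (n + 1) - y n) atTop (𝓝 0) ∧
    Tendsto (fun n => (inner ℝ (x n - xs) ((L†) (y n - ys)) : ℝ)) atTop (𝓝 0) ∧
    ∃ v, Tendsto (fun n => τ⁻¹ * ‖x n - xs‖ ^ 2 + σ⁻¹ * ‖y n - ys‖ ^ 2) atTop (𝓝 v) := by
  have key := asymptotics_of_gap_inequalities L hτ hσ hθ hstep
    (x := fun n => x n - xs) (y := fun n => y n - ys)
    -- The starting point need not lie in the domains; `F 0` and `G 0` enter no inequality.
    (F := fun n => φ (x n) - φ xs + inner ℝ (x n - xs) ((L†) ys))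
    (G := fun n => γ (y n) - γ ys - inner ℝ xs ((L†) (y n - ys)))
    (fun n => by linarith [hsP _ (hxD n)]) (fun n => by linarith [hsQ _ (hyE n)])
    (fun n => by
      have h := hP n xs hxs
      simp only [map_sub, inner_sub_left, inner_sub_right, mul_sub] at h ⊢
      linarith)
    (fun n => by
      have h := hQ n ys hys
      simp only [map_sub, inner_sub_left, inner_sub_right, inner_add_left, real_inner_smul_left,
        mul_sub] at h ⊢
      linarith)
    (fun n => by
      have h := hP (n + 1) (x (n + 1)) (hxD n)
      rw [sub_sub_sub_cancel_right, ← real_inner_self_eq_norm_sq]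
      simp only [map_sub, inner_sub_left, inner_sub_right, mul_sub] at h ⊢
      linarith)
    (fun n => by
      have h := hP n (x (n + 2)) (hxD (n + 1))
      simp only [map_sub, inner_sub_left, inner_sub_right, mul_sub] at h ⊢
      linarith)
  simpa only [sub_sub_sub_cancel_right] using key

/-! ### Weak limits, saddle inequalities and Opial's argument -/

lemma tendsto_toWeakSpace_prod {ι : Type*} {l : Filter ι} {x : ι → H} {y : ι → K} {p : H} {q : K}
    (hx : ∀ z, Tendsto (fun i => (inner ℝ z (x i) : ℝ)) l (𝓝 (inner ℝ z p)))
    (hy : ∀ z, Tendsto (fun i => (inner ℝ z (y i) : ℝ)) l (𝓝 (inner ℝ z q))) :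
    Tendsto (fun i => toWeakSpace ℝ (H × K) (x i, y i)) l (𝓝 (toWeakSpace ℝ (H × K) (p, q))) := by
  have hfun : ∀ φ : (H × K) →L[ℝ] ℝ,
      Tendsto (fun i => φ (x i, y i)) l (𝓝 (φ (p, q))) := by
    intro φ
    -- `H × K` carries the supremum norm, so Riesz representation is applied on each factor.
    have hφ : ∀ (a : H) (b : K), φ (a, b) =
        inner ℝ ((InnerProductSpace.toDual ℝ H).symm (φ.comp (ContinuousLinearMap.inl ℝ H K))) a +
        inner ℝ ((InnerProductSpace.toDual ℝ K).symm (φ.comp (ContinuousLinearMap.inr ℝ H K))) b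
        := by
      intro a b
      rw [InnerProductSpace.toDual_symm_apply, InnerProductSpace.toDual_symm_apply,
        ContinuousLinearMap.comp_apply, ContinuousLinearMap.comp_apply,
        ContinuousLinearMap.inl_apply, ContinuousLinearMap.inr_apply, ← map_add]
      simp
    simp only [hφ]
    exact (hx _).add (hy _)
  have hind : Topology.IsInducing
      (fun (v : WeakSpace ℝ (H × K)) φ => (topDualPairing ℝ (H × K)).flip v φ) := ⟨rfl⟩
  rw [hind.tendsto_nhds_iff, tendsto_pi_nhds]
  exact hfun

lemma inner_adjoint_tendsto_of_weak (L : H →L[ℝ] K) {ι : Type*} {l : Filter ι} {x : ι → H} {p : H}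
    (hx : ∀ z, Tendsto (fun i => (inner ℝ z (x i) : ℝ)) l (𝓝 (inner ℝ z p))) (w : K) :
    Tendsto (fun i => (inner ℝ (x i) ((L†) w) : ℝ)) l (𝓝 (inner ℝ p ((L†) w))) := by
  simpa only [real_inner_comm] using hx ((L†) w)

lemma inner_adjoint_tendsto_of_weak_right (L : H →L[ℝ] K) {ι : Type*} {l : Filter ι} {y : ι → K}
    {q : K} (hy : ∀ z, Tendsto (fun i => (inner ℝ z (y i) : ℝ)) l (𝓝 (inner ℝ z q))) (z : H) :
    Tendsto (fun i => (inner ℝ z ((L†) (y i)) : ℝ)) l (𝓝 (inner ℝ z ((L†) q))) := by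
  simpa only [ContinuousLinearMap.adjoint_inner_right] using hy (L z)

/-- If `p`, `q` are weak limits of `x`, `y` and the saddle inequalities hold at `x`, `y` up to
a vanishing error, then they hold at `p`, `q`. -/
lemma saddle_inequality_of_weak_limit {f : H → EReal} {h : K → EReal} (hf : ProperConvexLsc f)
    (hh : ProperConvexLsc h) (L : H →L[ℝ] K) {ι : Type*} {l : Filter ι} [l.NeBot]
    {x : ι → H} {y : ι → K} {p : H} {q : K}
    (hx : ∀ z, Tendsto (fun i => (inner ℝ z (x i) : ℝ)) l (𝓝 (inner ℝ z p)))
    (hy : ∀ z, Tendsto (fun i => (inner ℝ z (y i) : ℝ)) l (𝓝 (inner ℝ z q)))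
    (hfx : ∀ᶠ i in l, f (x i) ≠ ⊤) (hhy : ∀ᶠ i in l, h (y i) ≠ ⊤)
    (hsad : ∀ z w, f z ≠ ⊤ → h w ≠ ⊤ → ∃ e : ι → ℝ, Tendsto e l (𝓝 0) ∧ ∀ᶠ i in l,
      (f (x i)).toReal + (h (y i)).toReal - inner ℝ z ((L†) (y i)) + inner ℝ (x i) ((L†) w) + e i
        ≤ (f z).toReal + (h w).toReal) :
    f p ≠ ⊤ ∧ h q ≠ ⊤ ∧ ∀ z w, f z ≠ ⊤ → h w ≠ ⊤ →
      (f p).toReal + (h q).toReal - inner ℝ z ((L†) q) + inner ℝ p ((L†) w)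
        ≤ (f z).toReal + (h w).toReal := by
  -- Real numbers below `f p` and `h q` stand in for these values until they are known to be finite;
  -- an infinite value would allow an arbitrarily large α or β.
  have hlow : ∀ z w, f z ≠ ⊤ → h w ≠ ⊤ → ∀ α β : ℝ, (α : EReal) < f p → (β : EReal) < h q →
      α + β - inner ℝ z ((L†) q) + inner ℝ p ((L†) w) ≤ (f z).toReal + (h w).toReal := by
    intro z w hz hw α β hα hβ
    obtain ⟨e, he, hle⟩ := hsad z w hz hw
    have hlim : Tendsto (fun i => α + β - inner ℝ z ((L†) (y i)) + inner ℝ (x i) ((L†) w) + e i) l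
        (𝓝 (α + β - inner ℝ z ((L†) q) + inner ℝ p ((L†) w) + 0)) :=
      (((tendsto_const_nhds).sub (inner_adjoint_tendsto_of_weak_right L hy z)).add
        (inner_adjoint_tendsto_of_weak L hx w)).add he
    rw [add_zero] at hlim
    refine le_of_tendsto hlim ?_
    filter_upwards [hle, hf.eventually_lt hx hα, hh.eventually_lt hy hβ, hfx, hhy]
      with i hi h1 h2 h3 h4
    rw [← EReal.coe_toReal h3 (hf.proper.1 _), EReal.coe_lt_coe_iff] at h1
    rw [← EReal.coe_toReal h4 (hh.proper.1 _), EReal.coe_lt_coe_iff] at h2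
    linarith
  obtain ⟨z₀, hz₀⟩ := hf.proper.2
  obtain ⟨w₀, hw₀⟩ := hh.proper.2
  obtain ⟨α₀, -, hα₀⟩ := EReal.lt_iff_exists_real_btwn.1 (bot_lt_iff_ne_bot.2 (hf.proper.1 p))
  obtain ⟨β₀, -, hβ₀⟩ := EReal.lt_iff_exists_real_btwn.1 (bot_lt_iff_ne_bot.2 (hh.proper.1 q))
  have hp : f p ≠ ⊤ := by
    intro hp
    have := hlow z₀ w₀ hz₀ hw₀ ((f z₀).toReal + (h w₀).toReal - β₀ + inner ℝ z₀ ((L†) q)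
      - inner ℝ p ((L†) w₀) + 1) β₀ (by rw [hp]; exact EReal.coe_lt_top _) hβ₀
    linarith
  have hq : h q ≠ ⊤ := by
    intro hq
    have := hlow z₀ w₀ hz₀ hw₀ α₀ ((f z₀).toReal + (h w₀).toReal - α₀ + inner ℝ z₀ ((L†) q)
      - inner ℝ p ((L†) w₀) + 1) hα₀ (by rw [hq]; exact EReal.coe_lt_top _)
    linarith
  refine ⟨hp, hq, fun z w hz hw => le_of_forall_pos_le_add fun ε hε => ?_⟩
  have h1 : (((f p).toReal - ε / 2 : ℝ) : EReal) < f p := by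
    conv_rhs => rw [← EReal.coe_toReal hp (hf.proper.1 p)]
    rw [EReal.coe_lt_coe_iff]; linarith
  have h2 : (((h q).toReal - ε / 2 : ℝ) : EReal) < h q := by
    conv_rhs => rw [← EReal.coe_toReal hq (hh.proper.1 q)]
    rw [EReal.coe_lt_coe_iff]; linarith
  have := hlow z w hz hw _ _ h1 h2
  linarith

/-- Taking w = q, respectively z = p, decouples the joint inequality into the two subgradient
inclusions. -/
lemma isKKT_of_saddle_inequality {f : H → EReal} {g : K → EReal} (hf : IsProper f)
    (hg : IsProper (conjugate g)) (L : H →L[ℝ] K) {p : H} {q : K} (hp : f p ≠ ⊤)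
    (hq : conjugate g q ≠ ⊤)
    (hsad : ∀ z w, f z ≠ ⊤ → conjugate g w ≠ ⊤ →
      (f p).toReal + (conjugate g q).toReal - inner ℝ z ((L†) q) + inner ℝ p ((L†) w)
        ≤ (f z).toReal + (conjugate g w).toReal) : IsKKT f g L p q := by
  constructor
  · intro z
    by_cases hz : f z = ⊤
    · rw [hz]; exact le_top
    rw [← EReal.coe_toReal hp (hf.1 p), ← EReal.coe_toReal hz (hf.1 z), ← EReal.coe_add,
      EReal.coe_le_coe_iff, inner_neg_left, real_inner_comm, inner_sub_left]
    linarith [hsad z q hz hq]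
  · intro w
    by_cases hw : conjugate g w = ⊤
    · rw [hw]; exact le_top
    rw [← EReal.coe_toReal hq (hg.1 q), ← EReal.coe_toReal hw (hg.1 w), ← EReal.coe_add,
      EReal.coe_le_coe_iff, ← ContinuousLinearMap.adjoint_inner_right, map_sub, inner_sub_right]
    linarith [hsad p w hp hw]

/-- Opial's argument: a weak limit is determined by the distances to candidate limits. -/
lemma weak_limit_unique {H K : Type*} [NormedAddCommGroup H] [InnerProductSpace ℝ H]
    [NormedAddCommGroup K] [InnerProductSpace ℝ K] {τ σ : ℝ} (hτ : 0 < τ) (hσ : 0 < σ) {x : ℕ → H} {y : ℕ → K}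
    {p p' : H} {q q' : K} {l l' : Filter ℕ} [l.NeBot] [l'.NeBot] (hl : l ≤ atTop)
    (hl' : l' ≤ atTop)
    (hx : ∀ z, Tendsto (fun i => (inner ℝ z (x i) : ℝ)) l (𝓝 (inner ℝ z p)))
    (hy : ∀ z, Tendsto (fun i => (inner ℝ z (y i) : ℝ)) l (𝓝 (inner ℝ z q)))
    (hx' : ∀ z, Tendsto (fun i => (inner ℝ z (x i) : ℝ)) l' (𝓝 (inner ℝ z p')))
    (hy' : ∀ z, Tendsto (fun i => (inner ℝ z (y i) : ℝ)) l' (𝓝 (inner ℝ z q')))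
    (hv : ∃ v, Tendsto (fun n => τ * ‖x n - p‖ ^ 2 + σ * ‖y n - q‖ ^ 2) atTop (𝓝 v))
    (hv' : ∃ v, Tendsto (fun n => τ * ‖x n - p'‖ ^ 2 + σ * ‖y n - q'‖ ^ 2) atTop (𝓝 v)) :
    p = p' ∧ q = q' := by
  obtain ⟨v, hv⟩ := hv
  obtain ⟨v', hv'⟩ := hv'
  -- The difference of the two squared distances is affine in the iterates, so this functional
  -- converges along `atTop`; its limits along `l` and `l'` must agree.
  have hdiff : ∀ n, τ * inner ℝ (p - p') (x n) + σ * inner ℝ (q - q') (y n)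
      = ((τ * ‖x n - p'‖ ^ 2 + σ * ‖y n - q'‖ ^ 2) - (τ * ‖x n - p‖ ^ 2 + σ * ‖y n - q‖ ^ 2)
        + (τ * (‖p‖ ^ 2 - ‖p'‖ ^ 2) + σ * (‖q‖ ^ 2 - ‖q'‖ ^ 2))) / 2 := by
    intro n
    rw [norm_sub_sq_real, norm_sub_sq_real, norm_sub_sq_real, norm_sub_sq_real, inner_sub_left,
      inner_sub_left, real_inner_comm p, real_inner_comm p', real_inner_comm q,
      real_inner_comm q']
    ring
  have hlim : Tendsto (fun n => τ * inner ℝ (p - p') (x n) + σ * inner ℝ (q - q') (y n)) atTop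
      (𝓝 ((v' - v + (τ * (‖p‖ ^ 2 - ‖p'‖ ^ 2) + σ * (‖q‖ ^ 2 - ‖q'‖ ^ 2))) / 2)) := by
    simp only [hdiff]
    exact ((hv'.sub hv).add_const _).div_const 2
  have h1 := tendsto_nhds_unique (hlim.mono_left hl)
    (((hx (p - p')).const_mul τ).add ((hy (q - q')).const_mul σ))
  have h2 := tendsto_nhds_unique (hlim.mono_left hl')
    (((hx' (p - p')).const_mul τ).add ((hy' (q - q')).const_mul σ))
  have h3 : τ * ‖p - p'‖ ^ 2 + σ * ‖q - q'‖ ^ 2 = 0 := by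
    rw [← real_inner_self_eq_norm_sq, ← real_inner_self_eq_norm_sq, inner_sub_right,
      inner_sub_right]
    linarith
  have h4 : 0 ≤ τ * ‖p - p'‖ ^ 2 := by positivity
  have h5 : 0 ≤ σ * ‖q - q'‖ ^ 2 := by positivity
  have h6 : τ * ‖p - p'‖ ^ 2 = 0 := by linarith
  have h7 : σ * ‖q - q'‖ ^ 2 = 0 := by linarith
  constructor
  · simpa [hτ.ne', sub_eq_zero] using h6
  · simpa [hσ.ne', sub_eq_zero] using h7

/-! ### Application to the Chambolle–Pock iteration -/

lemma IsChambollePock.primal_inequality {f : H → EReal} {g : K → EReal} {L : H →L[ℝ] K}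
    {τ σ θ : ℝ} {x : ℕ → H} {y : ℕ → K} (hxy : IsChambollePock f g L τ σ θ x y)
    (hf : ProperConvexLsc f) (hτ : 0 < τ) (n : ℕ) {z : H} (hz : f z ≠ ⊤) :
    (f (x (n + 1))).toReal + τ⁻¹ * inner ℝ (x n - x (n + 1)) (z - x (n + 1))
      - inner ℝ (z - x (n + 1)) ((L†) (y n)) ≤ (f z).toReal := by
  refine le_trans (le_of_eq ?_) (toReal_le_of_mem_subdifferential hf.proper
    ((hxy n).1.mem_subdifferential hf.proper hf.convex) hz)
  rw [sub_right_comm, real_inner_smul_left, inner_sub_left (x n - x (n + 1)),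
    real_inner_smul_left, real_inner_comm (z - x (n + 1)) ((L†) (y n))]
  field_simp
  ring

lemma IsChambollePock.dual_inequality {f : H → EReal} {g : K → EReal} {L : H →L[ℝ] K}
    {τ σ θ : ℝ} {x : ℕ → H} {y : ℕ → K} (hxy : IsChambollePock f g L τ σ θ x y)
    (hg : ProperConvexLsc (conjugate g)) (hσ : 0 < σ) (n : ℕ) {w : K}
    (hw : conjugate g w ≠ ⊤) :
    (conjugate g (y (n + 1))).toReal + σ⁻¹ * inner ℝ (y n - y (n + 1)) (w - y (n + 1))
      + inner ℝ (x (n + 1) + θ • (x (n + 1) - x n)) ((L†) (w - y (n + 1)))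
      ≤ (conjugate g w).toReal := by
  refine le_trans (le_of_eq ?_) (toReal_le_of_mem_subdifferential hg.proper
    ((hxy n).2.mem_subdifferential hg.proper hg.convex) hw)
  rw [add_sub_right_comm, real_inner_smul_left, inner_add_left (y n - y (n + 1)),
    real_inner_smul_left, ContinuousLinearMap.adjoint_inner_right]
  field_simp
  ring

lemma tendsto_inner_zero_of_norm_le {E ι : Type*} [NormedAddCommGroup E] [InnerProductSpace ℝ E]
    {l : Filter ι} {u v : ι → E} {B : ℝ} (hu : Tendsto u l (𝓝 0)) (hv : ∀ i, ‖v i‖ ≤ B) :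
    Tendsto (fun i => (inner ℝ (u i) (v i) : ℝ)) l (𝓝 0) := by
  refine squeeze_zero_norm (fun i => ?_) (by simpa using hu.norm.mul_const B)
  exact (norm_inner_le_norm _ _).trans (mul_le_mul_of_nonneg_left (hv i) (norm_nonneg _))

/-- Weak limits of the Chambolle–Pock iterates are KKT points, provided the iterates are bounded
and asymptotically regular. -/
lemma IsChambollePock.isKKT_of_weak_limit {f : H → EReal} {g : K → EReal} {L : H →L[ℝ] K}
    {τ σ θ : ℝ} {x : ℕ → H} {y : ℕ → K} (hxy : IsChambollePock f g L τ σ θ x y)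
    (hf : ProperConvexLsc f) (hg : ProperConvexLsc (conjugate g)) (hτ : 0 < τ) (hσ : 0 < σ)
    {C : ℝ} (hC : ∀ n, ‖x (n + 1)‖ ≤ C ∧ ‖y (n + 1)‖ ≤ C)
    (hdx : Tendsto (fun n => x (n + 1) - x n) atTop (𝓝 0))
    (hdy : Tendsto (fun n => y (n + 1) - y n) atTop (𝓝 0))
    {l : Filter ℕ} [l.NeBot] (hl : l ≤ atTop) {p : H} {q : K}
    (hx : ∀ z, Tendsto (fun n => (inner ℝ z (x (n + 1)) : ℝ)) l (𝓝 (inner ℝ z p)))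
    (hy : ∀ z, Tendsto (fun n => (inner ℝ z (y (n + 1)) : ℝ)) l (𝓝 (inner ℝ z q))) :
    IsKKT f g L p q := by
  obtain ⟨hp, hq, hsad⟩ := saddle_inequality_of_weak_limit hf hg L hx hy
    (Eventually.of_forall fun n => (hxy n).1.ne_top hf.proper)
    (Eventually.of_forall fun n => (hxy n).2.ne_top hg.proper) (fun z w hz hw => by
      have hzx : ∀ n, ‖z - x (n + 1)‖ ≤ ‖z‖ + C := fun n =>
        (norm_sub_le _ _).trans (by linarith [(hC n).1])
      have hwy : ∀ n, ‖w - y (n + 1)‖ ≤ ‖w‖ + C := fun n =>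
        (norm_sub_le _ _).trans (by linarith [(hC n).2])
      have hLw : ∀ n, ‖(L†) (w - y (n + 1))‖ ≤ ‖L†‖ * (‖w‖ + C) := fun n =>
        ((L†).le_opNorm _).trans (mul_le_mul_of_nonneg_left (hwy n) (norm_nonneg _))
      have hdL : Tendsto (fun n => (L†) (y (n + 1) - y n)) l (𝓝 0) := by
        have := ((L†).continuous.tendsto 0).comp (hdy.mono_left hl)
        rwa [map_zero] at this
      -- The error left after adding the two inequalities: two proximal terms, the lag of `y n`
      -- behind `y (n + 1)` in the primal step, and the extrapolation.
      have t1 := (tendsto_inner_zero_of_norm_le (hdx.mono_left hl) hzx).const_mul (-τ⁻¹)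
      have t2 := (tendsto_inner_zero_of_norm_le (hdy.mono_left hl) hwy).const_mul (-σ⁻¹)
      have t3 := tendsto_inner_zero_of_norm_le hdL hzx
      have t4 := (tendsto_inner_zero_of_norm_le (hdx.mono_left hl) hLw).const_mul θ
      have t := ((t1.add t2).add t3).add t4
      simp only [mul_zero, add_zero] at t
      refine ⟨_, t, Eventually.of_forall fun n => ?_⟩
      have h1 := hxy.primal_inequality hf hτ n hz
      have h2 := hxy.dual_inequality hg hσ n hw
      rw [real_inner_comm (z - x (n + 1)) ((L†) (y (n + 1) - y n))]
      simp only [map_sub, inner_sub_left, inner_sub_right, inner_add_left, real_inner_smul_left]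
        at h1 h2 ⊢
      linarith)
  exact isKKT_of_saddle_inequality hf.proper hg.proper L hp hq hsad

/-- Asymptotics of the Chambolle–Pock iterates relative to a KKT point. -/
lemma IsChambollePock.asymptotics {f : H → EReal} {g : K → EReal} {L : H →L[ℝ] K}
    {τ σ θ : ℝ} {x : ℕ → H} {y : ℕ → K} (hxy : IsChambollePock f g L τ σ θ x y)
    (hf : ProperConvexLsc f) (hg : ProperConvexLsc (conjugate g)) (hτ : 0 < τ) (hσ : 0 < σ)
    (hθ : 1 / 2 < θ) (hstep : τ * σ * ‖L‖ ^ 2 < 4 / (1 + 2 * θ)) {xs : H} {ys : K}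
    (hs : IsKKT f g L xs ys) :
    (∃ C, ∀ n, ‖x (n + 1) - xs‖ ≤ C ∧ ‖y (n + 1) - ys‖ ≤ C) ∧
    Tendsto (fun n => x (n + 1) - x n) atTop (𝓝 0) ∧
    Tendsto (fun n => y (n + 1) - y n) atTop (𝓝 0) ∧
    ∃ v, Tendsto (fun n => τ⁻¹ * ‖x n - xs‖ ^ 2 + σ⁻¹ * ‖y n - ys‖ ^ 2) atTop (𝓝 v) := by
  obtain ⟨h1, h2, h3, -, h4⟩ := asymptotics_of_subgradient_inequalities L hτ hσ hθ hstep
    (φ := fun z => (f z).toReal) (γ := fun w => (conjugate g w).toReal)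
    (D := {z | f z ≠ ⊤}) (E := {w | conjugate g w ≠ ⊤}) (xs := xs) (ys := ys)
    (fun n => (hxy n).1.ne_top hf.proper) (fun n => (hxy n).2.ne_top hg.proper)
    (ne_top_of_mem_subdifferential hf.proper hs.1) (ne_top_of_mem_subdifferential hg.proper hs.2)
    (fun n z hz => hxy.primal_inequality hf hτ n hz)
    (fun n w hw => hxy.dual_inequality hg hσ n hw)
    (fun z hz => by
      have := toReal_le_of_mem_subdifferential hf.proper hs.1 hz
      rw [inner_neg_left, real_inner_comm] at this
      linarith)
    (fun w hw => by
      have := toReal_le_of_mem_subdifferential hg.proper hs.2 hw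
      rwa [← ContinuousLinearMap.adjoint_inner_right] at this)
  exact ⟨h1, h2, h3, h4⟩

end Convergence

end ChambollePock

theorem theorem2
    {H : Type*} [NormedAddCommGroup H] [InnerProductSpace ℝ H] [CompleteSpace H]
    {K : Type*} [NormedAddCommGroup K] [InnerProductSpace ℝ K] [CompleteSpace K]
    (f : H → EReal) (g : K → EReal) (L : H →L[ℝ] K)
    (hf : ChambollePock.ProperConvexLsc f) (hg : ChambollePock.ProperConvexLsc g)
    (hL : L ≠ 0)
    (hsol : ∃ (xs : H) (ys : K), ChambollePock.IsKKT f g L xs ys)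
    (τ σ θ : ℝ) (hτ : 0 < τ) (hσ : 0 < σ) (hθ : 1 / 2 < θ)
    (hstep : τ * σ * ‖L‖ ^ 2 < 4 / (1 + 2 * θ))
    (x : ℕ → H) (y : ℕ → K)
    (hxy : ChambollePock.IsChambollePock f g L τ σ θ x y) :
    ∃ (xs : H) (ys : K), ChambollePock.IsKKT f g L xs ys ∧
      Tendsto (fun k : ℕ => toWeakSpace ℝ (H × K) (x k, y k)) atTop
        (𝓝 (toWeakSpace ℝ (H × K) (xs, ys))) := by
  have hh := hg.conjugate
  obtain ⟨x₀, y₀, h₀⟩ := hsol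
  obtain ⟨⟨C, hC⟩, hdx, hdy, -⟩ := hxy.asymptotics hf hh hτ hσ hθ hstep h₀
  have hCx : ∀ n, ‖x (n + 1)‖ ≤ C + ‖x₀‖ := fun n => by
    have := norm_sub_norm_le (x (n + 1)) x₀
    linarith [(hC n).1]
  have hCy : ∀ n, ‖y (n + 1)‖ ≤ C + ‖y₀‖ := fun n => by
    have := norm_sub_norm_le (y (n + 1)) y₀
    linarith [(hC n).2]
  have hbdd : ∀ n, ‖x (n + 1)‖ ≤ C + ‖x₀‖ + ‖y₀‖ ∧ ‖y (n + 1)‖ ≤ C + ‖x₀‖ + ‖y₀‖ := fun n =>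
    ⟨by linarith [hCx n, norm_nonneg y₀], by linarith [hCy n, norm_nonneg x₀]⟩
  have hcluster : ∀ U : Ultrafilter ℕ, (U : Filter ℕ) ≤ atTop → ∃ p q,
      ChambollePock.IsKKT f g L p q ∧
      (∀ z, Tendsto (fun n => (inner ℝ z (x (n + 1)) : ℝ)) U (𝓝 (inner ℝ z p))) ∧
      (∀ z, Tendsto (fun n => (inner ℝ z (y (n + 1)) : ℝ)) U (𝓝 (inner ℝ z q))) := by
    intro U hU
    obtain ⟨p, hp⟩ := ChambollePock.exists_weak_limit U (Eventually.of_forall hCx)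
    obtain ⟨q, hq⟩ := ChambollePock.exists_weak_limit U (Eventually.of_forall hCy)
    exact ⟨p, q, hxy.isKKT_of_weak_limit hf hh hτ hσ hbdd hdx hdy hU hp hq, hp, hq⟩
  have hdist : ∀ p q, ChambollePock.IsKKT f g L p q → ∃ v, Tendsto
      (fun n => τ⁻¹ * ‖x (n + 1) - p‖ ^ 2 + σ⁻¹ * ‖y (n + 1) - q‖ ^ 2) atTop (𝓝 v) := by
    intro p q hpq
    obtain ⟨-, -, -, v, hv⟩ := hxy.asymptotics hf hh hτ hσ hθ hstep hpq
    exact ⟨v, hv.comp (tendsto_add_atTop_nat 1)⟩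
  obtain ⟨p, q, hpq, hp, hq⟩ := hcluster (Ultrafilter.of atTop) (Ultrafilter.of_le atTop)
  refine ⟨p, q, hpq, ?_⟩
  -- The limit along one fixed ultrafilter is the candidate; every other ultrafilter must give the
  -- same limit.
  rw [← tendsto_add_atTop_iff_nat 1, tendsto_iff_ultrafilter]
  intro U hU
  obtain ⟨p', q', hpq', hp', hq'⟩ := hcluster U hU
  obtain ⟨rfl, rfl⟩ := ChambollePock.weak_limit_unique (inv_pos.2 hτ) (inv_pos.2 hσ)
    (Ultrafilter.of_le atTop) hU hp hq hp' hq' (hdist p q hpq) (hdist p' q' hpq')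
  exact ChambollePock.tendsto_toWeakSpace_prod hp' hq'
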